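/- Let $X$ be a measurable space of field operator labels (a label may comprise a particle species and a position or momentum), and let $\mathsf{S}(V)$ be the free unital commutative $\mathbb{C}$-algebra generated by the field operators $\phi(x)$, $x\in X$, with the coproduct $\Delta$ that is the algebra homomorphism with $\Delta\phi(x)=\phi(x)\otimes\mathbf 1+\mathbf 1\otimes\phi(x)$. Let the inverse propagator be a symmetric kernel $K(x,y)\,\kappa(\mathrm dx\,\mathrm dy)$, where $\kappa$ is a $\sigma$-finite measure on $X\times X$ invariant under $(x,y)\mapsto(y,x)$ and $K:X\times X\to\mathbb{C}$ satisfies $K(x,y)=K(y,x)$ (for instance $\kappa=\mathrm dx\,\mathrm dy$ and $K=G_F^{-1}$). Let $\nu:\mathsf{S}(V)\to\mathbb{C}$ be linear; it encodes the vertex functions $\mathcal V(x_1,\dots,x_n)=\nu(\phi(x_1)\cdots\phi(x_n))$. On formal integral expressions with integrands in $\mathsf{S}(V)^{\otimes v}$, let $R_{i,j}$ be the multiplication by $\int\kappa(\mathrm dx\,\mathrm dy)\,K(x,y)\,\phi(x)_{(i)}\,\phi(y)_{(j)}$, where the index in brackets is the tensor factor in which the field is inserted; let $\Delta_i$ be $\Delta$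 applied to the $i$-th factor, and let $T_i=\tfrac12R_{i,i}$ and $Q_i=\tfrac12R_{i,i+1}\circ\Delta_i$. For $l\ge0$ and $v\ge1$ define $\Omega^{0,1}=\mathrm{id}$ and otherwise $$\Omega^{l,v}=\frac1{l+v-1}\Big(\sum_{i=1}^{v-1}Q_i\circ\Omega^{l,v-1}+\sum_{i=1}^{v}T_i\circ\Omega^{l-1,v}\Big),$$ where the first sum is absent if $v=1$ and the second if $l=0$. The map $\nu^{\otimes v}$ is applied to a formal integral by applying it to the integrand and then integrating. The value of a graph with $v$ vertices, $e$ internal edges (self-loops and multiple edges allowed) and $n$ external edges labelled $x_1,\dots,x_n$ is the integral with respect to $\kappa^{\otimes e}$, over labels of the two ends of each internal edge, of the product of $K$ over the internal edges and of $\mathcal V$ over the vertices, evaluated at the labels of the edge ends meeting there. Let $\sigma^{l,v}:\mathsf{S}(V)\to\mathbb{C}$ be the linear map such that $\sigma^{l,v}(\phi(x_1)\cdots\phi(x_n))$ is the sum, over all isomorphism classes (fixing the external edges) of connected graphs with $l$ loops, $v$ vertices and $n$ external edges labelled $x_1,\dots,x_n$, of the value of the graph divided by its symmetry factor (its number of automorphisms).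 Let $l\ge0$ and $v\ge1$, and suppose that the integrals defining the values of all connected graphs with $l$ loops and $v$ vertices converge absolutely. Then $\sigma^{l,v}$ is well defined, the integrals in $\nu^{\otimes v}\circ\Omega^{l,v}$ converge absolutely, and $$\sigma^{l,v}=\nu^{\otimes v}\circ\Omega^{l,v}.$$ -/

import Mathlib

open MeasureTheory
open scoped TensorProduct DirectSum

noncomputable section

namespace FeynmanHopf

/-! ## The algebra of field operators and its tensor powers -/

/-- The time-ordered field operator algebra `S(V)`: the free unital commutative `ℂ`-algebra on the
elementary field operators `φ(x)`, where `x` runs through the type `X` of operator labels.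
A label may comprise a particle species together with a position, a momentum, etc. -/
abbrev FieldAlgebra (X : Type*) := MvPolynomial X ℂ

/-- The elementary field operator `φ(x)`. -/
def field {X : Type*} (x : X) : FieldAlgebra X := MvPolynomial.X x

/-- The coproduct of `S(V)`: the algebra homomorphism with `φ(x) ↦ φ(x) ⊗ 1 + 1 ⊗ φ(x)`. -/
def coproduct (X : Type*) : FieldAlgebra X →ₐ[ℂ] FieldAlgebra X ⊗[ℂ] FieldAlgebra X :=
  MvPolynomial.aeval fun x => field x ⊗ₜ[ℂ] 1 + 1 ⊗ₜ[ℂ] field x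

/-- The `v`-fold tensor product `A ⊗ ⋯ ⊗ A` over `ℂ` of a commutative algebra. -/
abbrev AlgebraPow (A : Type*) [CommRing A] [Algebra ℂ A] (v : ℕ) := ⨂[ℂ] _ : Fin v, A

/-- `S(V)^{⊗ v}`, a commutative algebra for the factorwise product. -/
abbrev TensorPow (X : Type*) (v : ℕ) := AlgebraPow (FieldAlgebra X) v

/-- `s ↦ 1 ⊗ ⋯ ⊗ 1 ⊗ s ⊗ 1 ⊗ ⋯ ⊗ 1`, with `s` in position `i`. -/
def atVertex {X : Type*} {v : ℕ} (i : Fin v) : FieldAlgebra X →ₐ[ℂ] TensorPow X v :=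
  PiTensorProduct.singleAlgHom (R := ℂ) (A := fun _ : Fin v => FieldAlgebra X) i

/-- The multilinear map sending `(s₁, …, s_v)` to the product of the `f k (s k)`. -/
def prodMultilinear {X : Type*} {v : ℕ} {A : Type*} [CommRing A] [Algebra ℂ A]
    (f : Fin v → FieldAlgebra X →ₗ[ℂ] A) :
    MultilinearMap ℂ (fun _ : Fin v => FieldAlgebra X) A :=
  (MultilinearMap.mkPiAlgebra ℂ (Fin v) A).compLinearMap f

/-- The coproduct on the `i`-th factor, `Δ_i = id^{⊗ i-1} ⊗ Δ ⊗ id^{⊗ v-i}`. The factor `i` is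
split into the factors `i.castSucc` and `i.succ`; factors before `i` keep their position, those
after `i` are moved one position to the right. -/
def coproductAt {X : Type*} {v : ℕ} (i : Fin v) : TensorPow X v →ₗ[ℂ] TensorPow X (v + 1) :=
  PiTensorProduct.lift <| prodMultilinear fun k =>
    if k < i then (atVertex k.castSucc).toLinearMap
    else if k = i then
      ((Algebra.TensorProduct.lift (atVertex i.castSucc) (atVertex i.succ)
        fun _ _ => Commute.all _ _).comp (coproduct X)).toLinearMap
    else (atVertex k.succ).toLinearMap

/-- `ν^{⊗ v} : S(V)^{⊗ v} → ℂ`, that is `s₁ ⊗ ⋯ ⊗ s_v ↦ ν(s₁) ⋯ ν(s_v)`. -/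
def vertexTensor {X : Type*} (ν : FieldAlgebra X →ₗ[ℂ] ℂ) (v : ℕ) : TensorPow X v →ₗ[ℂ] ℂ :=
  PiTensorProduct.lift <| prodMultilinear fun _ => ν

/-! ## Formal integrals in `S(V)^{⊗ v}` -/

/-- Formal integral expressions with values in `S(V)^{⊗ v}`: finite sums of expressions
`∫ F(x₁, y₁, …, x_e, y_e) κ(dx₁ dy₁) ⋯ κ(dx_e dy_e)`, for various `e`. Such an integral is only
carried out after the application of `ν^{⊗ v}`; until then it is recorded by its integrands `F`. -/
abbrev FormalIntegral (X : Type*) (v : ℕ) := ⨁ e : ℕ, ((Fin e → X × X) → TensorPow X v)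

/-- The embedding of `S(V) = S(V)^{⊗ 1}` as expressions without integrations. -/
def constIntegral (X : Type*) : FieldAlgebra X →ₗ[ℂ] FormalIntegral X 1 :=
  (DirectSum.lof ℂ ℕ (fun e => (Fin e → X × X) → TensorPow X 1) 0) ∘ₗ
    (LinearMap.pi fun _ => (atVertex 0).toLinearMap)

/-- A linear map of tensor powers, extended to formal integrals by acting on the integrands. -/
def onIntegrands {X : Type*} {v w : ℕ} (L : TensorPow X v →ₗ[ℂ] TensorPow X w) :
    FormalIntegral X v →ₗ[ℂ] FormalIntegral X w :=
  DirectSum.lmap fun e => L.compLeft (Fin e → X × X)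

/-- Multiplication with
`R_{i,j} = ∫ κ(dx dy) K(x, y) (1 ⊗ ⋯ ⊗ φ(x) ⊗ ⋯ ⊗ φ(y) ⊗ ⋯ ⊗ 1)`, with `φ(x)` in position `i`
and `φ(y)` in position `j` (and with `φ(x) φ(y)` in position `i` when `j = i`). The new
integration variables are appended at the end. -/
def edgeOp {X : Type*} (K : X → X → ℂ) {v : ℕ} (i j : Fin v) :
    FormalIntegral X v →ₗ[ℂ] FormalIntegral X v :=
  DirectSum.toModule ℂ ℕ _ fun e =>
    (DirectSum.lof ℂ ℕ (fun e => (Fin e → X × X) → TensorPow X v) (e + 1)) ∘ₗ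
      (LinearMap.pi fun z : Fin (e + 1) → X × X =>
        (LinearMap.mulLeft ℂ (K (z (Fin.last e)).1 (z (Fin.last e)).2 •
          (atVertex i (field (z (Fin.last e)).1) * atVertex j (field (z (Fin.last e)).2)))) ∘ₗ
        (LinearMap.proj (Fin.init z : Fin e → X × X)))

/-- `T_i = (1/2) R_{i,i}`. -/
def opT {X : Type*} (K : X → X → ℂ) {v : ℕ} (i : Fin v) :
    FormalIntegral X v →ₗ[ℂ] FormalIntegral X v :=
  (1 / 2 : ℂ) • edgeOp K i i

/-- `Q_i = (1/2) R_{i,i+1} ∘ Δ_i`. -/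
def opQ {X : Type*} (K : X → X → ℂ) {v : ℕ} (i : Fin v) :
    FormalIntegral X v →ₗ[ℂ] FormalIntegral X (v + 1) :=
  (1 / 2 : ℂ) • (edgeOp K i.castSucc i.succ ∘ₗ onIntegrands (coproductAt i))

/-- The maps `Ω^{l,v}` for `v ≥ 1`: `Ω^{0,1} = id` and otherwise
`Ω^{l,v} = (l+v-1)⁻¹ (∑_{i=1}^{v-1} Q_i ∘ Ω^{l,v-1} + ∑_{i=1}^{v} T_i ∘ Ω^{l-1,v})`,
without the second sum when `l = 0` and without the first when `v = 1`. For `v = 0` the map is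
not meaningful, and set to `0`. -/
def Omega {X : Type*} (K : X → X → ℂ) : (l v : ℕ) → FieldAlgebra X →ₗ[ℂ] FormalIntegral X v
  | _, 0 => 0
  | 0, 1 => constIntegral X
  | 0, v + 2 => ((v + 1 : ℕ) : ℂ)⁻¹ • ∑ i : Fin (v + 1), opQ K i ∘ₗ Omega K 0 (v + 1)
  | l + 1, v + 1 => ((l + v + 1 : ℕ) : ℂ)⁻¹ •
      (∑ i : Fin v, opQ K i ∘ₗ Omega K (l + 1) v + ∑ i : Fin (v + 1), opT K i ∘ₗ Omega K l (v + 1))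
termination_by l v => (l, v)

/-- All integrals that occur when `ν^{⊗ v}` is applied to `f` converge absolutely. -/
def Converges {X : Type*} [MeasurableSpace X] (κ : Measure (X × X))
    (ν : FieldAlgebra X →ₗ[ℂ] ℂ) {v : ℕ} (f : FormalIntegral X v) : Prop :=
  ∀ e : ℕ, Integrable (fun z => vertexTensor ν v (f e z)) (Measure.pi fun _ : Fin e => κ)

/-- The application of `ν^{⊗ v}` to a formal integral: `ν^{⊗ v}` is applied to the integrands,
then the integrals are carried out. -/
def applyVertex {X : Type*} [MeasurableSpace X] (κ : Measure (X × X))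
    (ν : FieldAlgebra X →ₗ[ℂ] ℂ) {v : ℕ} (f : FormalIntegral X v) : ℂ :=
  ∑ᶠ e : ℕ, ∫ z, vertexTensor ν v (f e z) ∂(Measure.pi fun _ : Fin e => κ)

/-! ## Feynman graphs -/

/-- A graph with `v` vertices, `e` internal edges (self-loops and multiple edges are allowed)
and `n` external edges, with all of them numbered, and with orientations of the internal edges.
Only the numbering of the external edges is kept by isomorphisms. -/
@[ext]
structure FeynmanGraph (v e n : ℕ) where
  /-- the vertex at which an external edge ends -/
  leg : Fin n → Fin v
  /-- the two end vertices of an internal edge -/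
  ends : Fin e → Fin v × Fin v

namespace FeynmanGraph

variable {v e n : ℕ}

/-- The graph is non-empty, and any two vertices are joined by a path of internal edges. -/
def Connected (G : FeynmanGraph v e n) : Prop :=
  (SimpleGraph.fromRel fun a b => ∃ k, G.ends k = (a, b)).Connected

/-- An isomorphism of graphs: a bijection of the vertices and a bijection of the internal edges
including their two ends, which preserve incidence and fix each external edge. -/
@[ext]
structure Iso (G H : FeynmanGraph v e n) where
  /-- the bijection of the vertices -/
  vertex : Equiv.Perm (Fin v)
  /-- the bijection of the internal edges -/
  edge : Equiv.Perm (Fin e)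
  /-- whether the two ends of an internal edge are interchanged -/
  flip : Fin e → Bool
  leg_eq : ∀ k, H.leg k = vertex (G.leg k)
  ends_eq : ∀ k, H.ends (edge k) =
    if flip k then (vertex (G.ends k).2, vertex (G.ends k).1)
    else (vertex (G.ends k).1, vertex (G.ends k).2)

/-- The identity isomorphism. -/
def Iso.refl (G : FeynmanGraph v e n) : Iso G G where
  vertex := 1
  edge := 1
  flip _ := false
  leg_eq _ := rfl
  ends_eq _ := rfl

/-- The inverse isomorphism. -/
def Iso.symm {G H : FeynmanGraph v e n} (f : Iso G H) : Iso H G where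
  vertex := f.vertex⁻¹
  edge := f.edge⁻¹
  flip k := f.flip (f.edge⁻¹ k)
  leg_eq k := by simp [f.leg_eq k]
  ends_eq k := by
    have h := f.ends_eq (f.edge⁻¹ k)
    rw [show f.edge (f.edge⁻¹ k) = k from f.edge.apply_symm_apply k] at h
    rw [h]
    cases f.flip (f.edge⁻¹ k) <;> simp

/-- The composition of isomorphisms. -/
def Iso.trans {G H J : FeynmanGraph v e n} (f : Iso G H) (g : Iso H J) : Iso G J where
  vertex := g.vertex * f.vertex
  edge := g.edge * f.edge
  flip k := xor (f.flip k) (g.flip (f.edge k))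
  leg_eq k := by simp [g.leg_eq k, f.leg_eq k]
  ends_eq k := by
    have h := g.ends_eq (f.edge k)
    rw [Equiv.Perm.mul_apply, h, f.ends_eq k]
    cases f.flip k <;> cases g.flip (f.edge k) <;> simp

/-- The symmetry factor of a graph: the number of its automorphisms. -/
def symmetryFactor (G : FeynmanGraph v e n) : ℕ := Nat.card (Iso G G)

/-- The product of the field operators at the vertex `i`, for external edges labelled by `x` and
internal edges whose ends are labelled by `z`. -/
def fieldsAt {X : Type*} (G : FeynmanGraph v e n) (x : Fin n → X) (z : Fin e → X × X) (i : Fin v) :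
    FieldAlgebra X :=
  (∏ k : Fin n, if G.leg k = i then field (x k) else 1) *
    ∏ k : Fin e, (if (G.ends k).1 = i then field (z k).1 else 1) *
      (if (G.ends k).2 = i then field (z k).2 else 1)

/-- The integrand of the Feynman graph `G`: each internal edge contributes the kernel `K` at the
labels of its two ends, each vertex contributes the vertex function at the labels of the
edge ends that meet there. -/
def integrand {X : Type*} (K : X → X → ℂ) (ν : FieldAlgebra X →ₗ[ℂ] ℂ) (G : FeynmanGraph v e n)
    (x : Fin n → X) (z : Fin e → X × X) : ℂ :=
  (∏ k : Fin e, K (z k).1 (z k).2) * ∏ i : Fin v, ν (G.fieldsAt x z i)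

/-- The value of `G` as a Feynman graph. -/
def value {X : Type*} [MeasurableSpace X] (κ : Measure (X × X)) (K : X → X → ℂ)
    (ν : FieldAlgebra X →ₗ[ℂ] ℂ) (G : FeynmanGraph v e n) (x : Fin n → X) : ℂ :=
  ∫ z, G.integrand K ν x z ∂(Measure.pi fun _ : Fin e => κ)

end FeynmanGraph

/-- Connected graphs with `l` loops, `v` vertices and `n` external edges: a connected graph with
`v ≥ 1` vertices has `l` independent loops exactly when it has `l + v - 1` internal edges. -/
abbrev ConnectedGraph (l v n : ℕ) := {G : FeynmanGraph v (l + v - 1) n // G.Connected}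

/-- Isomorphism of connected graphs. -/
def isoSetoid (l v n : ℕ) : Setoid (ConnectedGraph l v n) where
  r G H := Nonempty (FeynmanGraph.Iso G.1 H.1)
  iseqv :=
    { refl := fun G => ⟨FeynmanGraph.Iso.refl G.1⟩
      symm := fun ⟨f⟩ => ⟨f.symm⟩
      trans := fun ⟨f⟩ ⟨g⟩ => ⟨f.trans g⟩ }

/-- The `l`-loop and `v`-vertex contribution to the connected `n`-point function
`G_c^{(n)}(x₁, …, x_n)`: the sum over all isomorphism classes of connected graphs with `l` loops,
`v` vertices and `n` external edges labelled by `x₁, …, x_n` of the value of the graph, with the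
inverse of its symmetry factor as weight. -/
def connectedContribution {X : Type*} [MeasurableSpace X] (κ : Measure (X × X)) (K : X → X → ℂ)
    (ν : FieldAlgebra X →ₗ[ℂ] ℂ) (l v : ℕ) {n : ℕ} (x : Fin n → X) : ℂ :=
  ∑ᶠ q : Quotient (isoSetoid l v n),
    (q.out.1.symmetryFactor : ℂ)⁻¹ * q.out.1.value κ K ν x

/-- The linear map `σ^{l,v} : S(V) → ℂ` that collects the contributions for all `n`: on the basis
of monomials, it sends `φ(x₁) ⋯ φ(x_n)` to the contribution to `G_c^{(n)}(x₁, …, x_n)`. -/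
def sigma {X : Type*} [MeasurableSpace X] (κ : Measure (X × X)) (K : X → X → ℂ)
    (ν : FieldAlgebra X →ₗ[ℂ] ℂ) (l v : ℕ) : FieldAlgebra X →ₗ[ℂ] ℂ :=
  (MvPolynomial.basisMonomials X ℂ).constr ℂ fun m =>
    connectedContribution κ K ν l v (Finsupp.toMultiset m).toList.get

end FeynmanHopf

end

open FeynmanHopf

/-! Both sides are compared with a sum over graphs whose vertices and internal edges are numbered
and whose internal edges are oriented, so that symmetry factors appear only through counting.

Put `e = l + v - 1`. Each `T_i` adds a self-loop, and each `Q_i` splits a vertex in all possible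
ways and joins the two halves. Numbering the internal edges in order of creation, one finds
(`Omega_prod_field`) that `Ω^{l,v}(φ(x₁) ⋯ φ(x_n))` is the sum over numbered graphs with weight
`histories / (e! 2 ^ e)`, where the factors `1 / (l + v - 1)` and `1 / 2` of each step multiply to
the constant.

The number of histories depends on the numbering, but its sum over all vertex numberings and
orientations does not: it is `2 ^ e` for a connected graph and `0` otherwise (`sum_histories`). By
induction, the last edge is deleted if it is a self-loop and contracted if not. Numberings that
place its ends at neighbours `i`, `i + 1` correspond to numberings of the contracted graph
(`sum_perm_adjacent`), and the two orientations give the factor `2`. Since values are invariant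
under isomorphism (`Iso.value_eq`), averaging turns the weight of every connected numbered graph
into `1 / (v! e! 2 ^ e)`.

On the other side, a connected graph has `v! e! 2 ^ e` relabellings, counted with multiplicity
(`sum_card_iso`), so its class has `v! e! 2 ^ e / |Aut|` members. Weight `1 / |Aut|` per class is
therefore weight `1 / (v! e! 2 ^ e)` per numbered graph. -/

noncomputable section

/-! ### Numbered, oriented graphs and operations on them. -/

namespace FeynmanHopf.FeynmanGraph

variable {v w e n : ℕ}

/-- A graph is given by the ends of its external and of its internal edges. -/
def equivProd : FeynmanGraph v e n ≃ (Fin n → Fin v) × (Fin e → Fin v × Fin v) where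
  toFun G := (G.leg, G.ends)
  invFun p := ⟨p.1, p.2⟩

instance : DecidableEq (FeynmanGraph v e n) := Classical.decEq _

instance : Fintype (FeynmanGraph v e n) := Fintype.ofEquiv _ equivProd.symm

/-- The graph obtained by replacing the vertices along a map. -/
def map (f : Fin v → Fin w) (G : FeynmanGraph v e n) : FeynmanGraph w e n where
  leg := f ∘ G.leg
  ends := Prod.map f f ∘ G.ends

/-- The graph without its last internal edge. -/
def init (G : FeynmanGraph v (e + 1) n) : FeynmanGraph v e n where
  leg := G.leg
  ends := Fin.init G.ends

/-- The graph with an internal edge added at the end. -/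
def snoc (G : FeynmanGraph v e n) (p : Fin v × Fin v) : FeynmanGraph v (e + 1) n where
  leg := G.leg
  ends := Fin.snoc G.ends p

/-- The graph with some of the internal edges reversed. -/
def flipEnds (ε : Fin e → Bool) (G : FeynmanGraph v e n) : FeynmanGraph v e n where
  leg := G.leg
  ends k := if ε k then (G.ends k).swap else G.ends k

@[simp] lemma map_ends (f : Fin v → Fin w) (G : FeynmanGraph v e n) (k : Fin e) :
    (G.map f).ends k = Prod.map f f (G.ends k) := rfl

@[simp] lemma init_snoc (G : FeynmanGraph v e n) (p : Fin v × Fin v) : (G.snoc p).init = G := by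
  ext1 <;> simp [snoc, init]

@[simp] lemma snoc_ends_last (G : FeynmanGraph v e n) (p : Fin v × Fin v) :
    (G.snoc p).ends (Fin.last e) = p := by
  simp [snoc]

/-- Removing and adding the last internal edge. -/
def snocEquiv : FeynmanGraph v e n × (Fin v × Fin v) ≃ FeynmanGraph v (e + 1) n where
  toFun p := p.1.snoc p.2
  invFun G := (G.init, G.ends (Fin.last e))
  left_inv p := by simp
  right_inv G := by ext1 <;> simp [snoc, init]

lemma map_comp {u : ℕ} (f : Fin v → Fin w) (g : Fin w → Fin u) (G : FeynmanGraph v e n) :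
    (G.map f).map g = G.map (g ∘ f) := rfl

lemma map_init (f : Fin v → Fin w) (G : FeynmanGraph v (e + 1) n) :
    (G.map f).init = G.init.map f := rfl

lemma flipEnds_map (f : Fin v → Fin w) (ε : Fin e → Bool) (G : FeynmanGraph v e n) :
    (G.map f).flipEnds ε = (G.flipEnds ε).map f := by
  ext1
  · rfl
  · funext k
    by_cases h : ε k <;> simp [flipEnds, map, h, Prod.map, Prod.swap]

lemma flipEnds_snoc_init (ε : Fin e → Bool) (b : Bool) (G : FeynmanGraph v (e + 1) n) :
    (G.flipEnds (Fin.snoc ε b)).init = G.init.flipEnds ε := by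
  ext1
  · rfl
  · funext k
    simp [flipEnds, init, Fin.init]

lemma flipEnds_snoc_last (ε : Fin e → Bool) (b : Bool) (G : FeynmanGraph v (e + 1) n) :
    (G.flipEnds (Fin.snoc ε b)).ends (Fin.last e) =
      if b then (G.ends (Fin.last e)).swap else G.ends (Fin.last e) := by
  simp [flipEnds]

lemma flipEnds_flipEnds (ε : Fin e → Bool) (G : FeynmanGraph v e n) :
    (G.flipEnds ε).flipEnds ε = G := by
  ext1
  · rfl
  · funext k
    by_cases h : ε k <;> simp [flipEnds, h]

/-! ### Connectedness -/

/-- Phrasing connectedness through vertex predicates constant along edges makes deletion of an edge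
the loss of one condition, and contraction a pullback of predicates. -/
lemma connected_iff (G : FeynmanGraph v e n) : G.Connected ↔
    v ≠ 0 ∧ ∀ S : Fin v → Prop, (∀ k, S (G.ends k).1 ↔ S (G.ends k).2) → ∀ a b, S a → S b := by
  rw [Connected, SimpleGraph.connected_iff, and_comm, ← Fin.pos_iff_nonempty, pos_iff_ne_zero]
  refine and_congr_right fun _ => ⟨fun h S hS a b => ?_, fun h a b => ?_⟩
  · obtain ⟨p⟩ := h a b
    induction p with
    | nil => exact id
    | cons hadj _ ih =>
      refine fun ha => ih ?_
      rw [SimpleGraph.fromRel_adj] at hadj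
      obtain ⟨_, ⟨k, hk⟩ | ⟨k, hk⟩⟩ := hadj
      · simpa [hk, ha] using hS k
      · simpa [hk, ha] using hS k
  · refine h (fun c => SimpleGraph.Reachable _ a c) (fun k => ?_) a b (SimpleGraph.Reachable.refl a)
    by_cases hk : (G.ends k).1 = (G.ends k).2
    · rw [hk]
    · have : (SimpleGraph.fromRel fun a b => ∃ k, G.ends k = (a, b)).Adj
          (G.ends k).1 (G.ends k).2 := by
        rw [SimpleGraph.fromRel_adj]
        exact ⟨hk, Or.inl ⟨k, rfl⟩⟩
      exact ⟨fun h => h.trans this.reachable, fun h => h.trans this.symm.reachable⟩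

lemma connected_zero_iff (G : FeynmanGraph v 0 n) : G.Connected ↔ v = 1 := by
  rw [connected_iff]
  constructor
  · rintro ⟨hv, h⟩
    by_contra hv1
    have := h (fun c => c.val = 0) (fun k => k.elim0) ⟨0, by omega⟩ ⟨1, by omega⟩ rfl
    simp at this
  · rintro rfl
    exact ⟨one_ne_zero, fun S _ a b h => Subsingleton.elim a b ▸ h⟩

lemma connected_iff_init (G : FeynmanGraph v (e + 1) n)
    (h : (G.ends (Fin.last e)).1 = (G.ends (Fin.last e)).2) : G.Connected ↔ G.init.Connected := by
  simp only [connected_iff, Fin.forall_fin_succ', h, and_true, init, Fin.init]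

/-- Contraction of the last internal edge preserves connectedness. -/
lemma connected_iff_contract (G : FeynmanGraph (v + 1) (e + 1) n) (b : Fin (v + 1)) (a : Fin v)
    (h : G.ends (Fin.last e) = (b.succAbove a, b) ∨ G.ends (Fin.last e) = (b, b.succAbove a)) :
    G.Connected ↔ (G.init.map (b.insertNth a id : Fin (v + 1) → Fin v)).Connected := by
  have hlast (S : Fin (v + 1) → Prop) : (S (G.ends (Fin.last e)).1 ↔ S (G.ends (Fin.last e)).2) ↔
      (S (b.succAbove a) ↔ S b) := by
    rcases h with h | h <;> simp [h, iff_comm]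
  rw [connected_iff, connected_iff]
  have hv : v ≠ 0 := fun hv => (hv ▸ a).elim0
  simp only [hv, ne_eq, not_false_eq_true, true_and, Nat.add_eq_zero_iff, one_ne_zero, and_false]
  -- A predicate that agrees on the two ends of the last edge is pulled back from the contracted
  -- vertex set.
  have hq : ∀ S : Fin (v + 1) → Prop, (S (b.succAbove a) ↔ S b) → ∀ c,
      (S c ↔ S (b.succAbove ((b.insertNth a id : Fin (v + 1) → Fin v) c))) := by
    intro S hS c
    induction c using Fin.succAboveCases b with
    | x => simp [hS]
    | p c => simp
  constructor
  · intro H S hS c d hc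
    have := H (S ∘ (b.insertNth a id : Fin (v + 1) → Fin v))
      (Fin.forall_fin_succ'.2 ⟨hS, (hlast _).2 (by simp)⟩) (b.succAbove c) (b.succAbove d)
    simpa using this (by simpa using hc)
  · intro H S hS c d hc
    have hS' := (hlast S).1 (hS _)
    rw [hq S hS' d]
    refine H (S ∘ b.succAbove) (fun k => ?_) _ _ ((hq S hS' c).1 hc)
    have := hS k.castSucc
    rwa [hq S hS' (G.ends _).1, hq S hS' (G.ends _).2] at this

/-! ### The number of ways to build a graph -/

/-- The number of ways in which a graph arises from the one-vertex graph without internal edges,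
when in each step either a self-loop is added, or a vertex `i` is split into `i` and `i + 1`, which
are then joined by a new internal edge. -/
def histories : (v e : ℕ) → FeynmanGraph v e n → ℕ
  | 0, _, _ => 0
  | v + 1, 0, _ => if v = 0 then 1 else 0
  | v + 1, e + 1, G =>
    -- The last edge shows the last step: equal ends mean a self-loop, while ends `i`, `i + 1` in
    -- this order mean a split, undone by `i.predAbove`, which merges these two vertices.
    (if (G.ends (Fin.last e)).1 = (G.ends (Fin.last e)).2 then histories (v + 1) e G.init else 0) +
      ∑ i : Fin v, if G.ends (Fin.last e) = (i.castSucc, i.succ) then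
        histories v e (G.init.map (Fin.predAbove i)) else 0
termination_by _ e => e

/-- A step adds at most one vertex and always one edge. This kills the self-loop term of the
recursion for trees, matching the missing second sum of `Omega` at `l = 0`. -/
lemma histories_eq_zero : ∀ (e v : ℕ) (G : FeynmanGraph v e n), e + 1 < v → histories v e G = 0
  | _, 0, _, h => by omega
  | 0, _ + 1, G, h => by
    rw [histories, if_neg (by omega)]
  | e + 1, _ + 1, G, h => by
    rw [histories, histories_eq_zero e _ G.init (by omega)]
    simp only [ite_self, zero_add]
    refine Finset.sum_eq_zero fun i _ => ?_
    rw [histories_eq_zero e _ _ (by omega), ite_self]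

lemma predAbove_succ_succAbove (i k : Fin v) : i.predAbove (i.succ.succAbove k) = k := by
  rcases le_or_gt k i with h | h
  · rw [Fin.succAbove_of_castSucc_lt _ _ (by simpa [Fin.lt_def, Nat.lt_succ_iff] using h),
      Fin.predAbove_castSucc_of_le _ _ h]
  · rw [Fin.succAbove_of_le_castSucc _ _ (by simpa [Fin.le_def, Nat.succ_le_iff] using h),
      Fin.predAbove_succ_of_le _ _ h.le]

/-- The permutations that send two given points to neighbours `i` and `i + 1`, in this order,
correspond to the permutations of the set in which the points are identified. -/
lemma sum_perm_adjacent (b : Fin (v + 1)) (a : Fin v) (F : (Fin (v + 1) → Fin v) → ℕ) :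
    ∑ π : Equiv.Perm (Fin (v + 1)), ∑ i : Fin v,
      (if π (b.succAbove a) = i.castSucc ∧ π b = i.succ then F (i.predAbove ∘ π) else 0) =
    ∑ π : Equiv.Perm (Fin v), F (π ∘ (b.insertNth a id : Fin (v + 1) → Fin v)) := by
  -- Extends `π` by `b ↦ j`; the other points follow `π`, renumbered to skip `b` in the source and
  -- `j` in the target.
  let up (π : Equiv.Perm (Fin v)) (j : Fin (v + 1)) : Equiv.Perm (Fin (v + 1)) :=
    (finSuccEquiv' b).trans ((Equiv.optionCongr π).trans (finSuccEquiv' j).symm)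
  have up_b (π j) : up π j b = j := by simp [up]
  have up_s (π j k) : up π j (b.succAbove k) = j.succAbove (π k) := by simp [up]
  have comp_eq (π : Equiv.Perm (Fin v)) : (π a).predAbove ∘ up π (π a).succ =
      π ∘ (b.insertNth a id : Fin (v + 1) → Fin v) := by
    funext c
    induction c using Fin.succAboveCases b with
    | x => simp [up_b]
    | p c => simp [up_s, predAbove_succ_succAbove]
  rw [← Fintype.sum_prod_type', ← Finset.sum_filter]
  symm
  -- The position `i` is forced to be `π a`, and `b` must then go to its successor.
  refine Finset.sum_bij (fun π _ => (up π (π a).succ, π a)) ?_ ?_ ?_ ?_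
  · intro π _
    simp [up_b, up_s]
  · intro π _ π' _ h
    simp only [Prod.mk.injEq] at h
    obtain ⟨h, ha⟩ := h
    ext c : 1
    have := congrArg (fun σ : Equiv.Perm (Fin (v + 1)) => σ (b.succAbove c)) h
    simp only [up_s, ha] at this
    exact Fin.succAbove_right_injective this
  · rintro ⟨σ, i⟩ h
    simp only [Finset.mem_filter, Finset.mem_univ, true_and] at h
    have hn : ((finSuccEquiv' b).symm.trans (σ.trans (finSuccEquiv' i.succ))) none = none := by
      simp [h.2]
    let π := Equiv.removeNone ((finSuccEquiv' b).symm.trans (σ.trans (finSuccEquiv' i.succ)))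
    have hπ (k) : i.succ.succAbove (π k) = σ (b.succAbove k) := by
      have hk : ∃ x', ((finSuccEquiv' b).symm.trans (σ.trans (finSuccEquiv' i.succ))) (some k) =
          some x' := by
        rw [← Option.ne_none_iff_exists', ← hn]
        exact fun hh => by simpa using Equiv.injective _ hh
      have := Equiv.removeNone_some _ hk
      change some (π k) = _ at this
      simp only [Equiv.trans_apply, finSuccEquiv'_symm_some] at this
      have := congrArg (finSuccEquiv' i.succ).symm this
      simpa using this
    have ha : π a = i := by
      have := hπ a
      rw [h.1, ← Fin.succAbove_of_castSucc_lt _ _ i.castSucc_lt_succ] at this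
      exact Fin.succAbove_right_injective this
    refine ⟨π, Finset.mem_univ _, ?_⟩
    rw [Prod.mk.injEq]
    refine ⟨?_, ha⟩
    ext c : 1
    induction c using Fin.succAboveCases b with
    | x => rw [up_b, ha, h.2]
    | p c => rw [up_s, ha, hπ]
  · intro π _
    simp only [comp_eq]

open Classical in
/-- Summed over all numberings of the vertices and all orientations of the internal edges, the
number of ways to build a connected graph with `e` internal edges is `2 ^ e`. -/
theorem sum_histories : ∀ (e v : ℕ) (G : FeynmanGraph v e n),
    ∑ π : Equiv.Perm (Fin v), ∑ ε : Fin e → Bool, histories v e ((G.flipEnds ε).map π) =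
      if G.Connected then 2 ^ e else 0
  | e, 0, G => by
    simp [histories, connected_iff]
  | 0, v + 1, G => by
    simp only [histories, connected_zero_iff, Nat.add_eq_right]
    by_cases h : v = 0
    · subst h; simp
    · simp [h]
  | e + 1, v + 1, G => by
    -- The orientation of the last edge is separated from the others, which are left to the
    -- induction.
    have split (π : Equiv.Perm (Fin (v + 1))) :
        ∑ ε : Fin (e + 1) → Bool, histories (v + 1) (e + 1) ((G.flipEnds ε).map π) =
        ∑ b : Bool, ∑ ε : Fin e → Bool,
          histories (v + 1) (e + 1) ((G.flipEnds (Fin.snoc ε b)).map π) := by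
      rw [← Fintype.sum_prod_type', ← (Fin.snocEquiv fun _ => Bool).sum_comp]
      rfl
    simp only [split]
    simp only [histories, map_init, flipEnds_snoc_init, map_ends, flipEnds_snoc_last, map_comp]
    -- The contribution of one orientation of a last edge that is not a self-loop.
    have key (a b : Fin (v + 1)) (hab : a ≠ b)
        (h : G.ends (Fin.last e) = (a, b) ∨ G.ends (Fin.last e) = (b, a)) :
        ∑ π : Equiv.Perm (Fin (v + 1)), ∑ ε : Fin e → Bool, ∑ i : Fin v,
          (if π a = i.castSucc ∧ π b = i.succ then
            histories v e ((G.init.flipEnds ε).map (i.predAbove ∘ π)) else 0) =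
        if G.Connected then 2 ^ e else 0 := by
      obtain ⟨a, rfl⟩ := Fin.exists_succAbove_eq hab
      rw [connected_iff_contract G b a h, ← sum_histories e v]
      simp only [flipEnds_map, map_comp]
      rw [Finset.sum_comm]
      conv_rhs => rw [Finset.sum_comm]
      exact Finset.sum_congr rfl fun ε _ =>
        sum_perm_adjacent b a fun f => histories v e ((G.init.flipEnds ε).map f)
    generalize hp : G.ends (Fin.last e) = p at key
    obtain ⟨a, b⟩ := p
    by_cases hab : a = b
    · subst hab
      -- A self-loop never arises from a split; both of its orientations give the same count.
      have : ∀ (π : Equiv.Perm (Fin (v + 1))) (i : Fin v), ¬ (π a = i.castSucc ∧ π a = i.succ) :=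
        fun π i h => i.castSucc_lt_succ.ne (h.1.symm.trans h.2)
      rw [connected_iff_init G (by simp [hp])]
      have ih := sum_histories e (v + 1) G.init
      simp only [Prod.swap_prod_mk, ite_self, Prod.map, Prod.mk.injEq, this, if_true, if_false,
        Finset.sum_const_zero, add_zero, Fintype.sum_bool, Finset.sum_add_distrib, ih]
      split_ifs <;> ring
    · have h1 := key a b hab (Or.inl rfl)
      have h2 := key b a (Ne.symm hab) (Or.inr rfl)
      simp only [Fintype.sum_bool, Prod.swap_prod_mk, if_true, Bool.false_eq_true, if_false,
        Prod.map, Prod.mk.injEq, EmbeddingLike.apply_eq_iff_eq, hab, Ne.symm hab, zero_add,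
        Finset.sum_const_zero, Finset.sum_add_distrib, h1, h2]
      split_ifs <;> ring

/-- The histories of `G` itself are one summand of a vanishing sum of naturals if `G` is
disconnected. Hence only integrals of connected graphs occur in `Omega`. -/
lemma connected_of_histories_ne_zero {G : FeynmanGraph v e n} (h : histories v e G ≠ 0) :
    G.Connected := by
  by_contra hG
  have := sum_histories e v G
  rw [if_neg hG, Finset.sum_eq_zero_iff] at this
  have := Finset.sum_eq_zero_iff.1 (this 1 (Finset.mem_univ _)) (fun _ => false) (Finset.mem_univ _)
  exact h (by simpa [flipEnds, map] using this)

end FeynmanHopf.FeynmanGraph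

namespace FeynmanHopf

variable {X : Type*} {v w e n : ℕ}

/-! ### Algebra homomorphisms on tensor powers -/

/-- The algebra homomorphism on a tensor power that is given by `f k` on the factor `k`. -/
def prodAlgHom {A : Type*} [CommRing A] [Algebra ℂ A] (f : Fin v → FieldAlgebra X →ₐ[ℂ] A) :
    TensorPow X v →ₐ[ℂ] A :=
  PiTensorProduct.liftAlgHom (prodMultilinear fun k => (f k).toLinearMap)
    (by simp [prodMultilinear]) (by simp [prodMultilinear, Finset.prod_mul_distrib])

lemma prodAlgHom_atVertex {A : Type*} [CommRing A] [Algebra ℂ A]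
    (f : Fin v → FieldAlgebra X →ₐ[ℂ] A) (k : Fin v) (s : FieldAlgebra X) :
    prodAlgHom f (atVertex k s) = f k s := by
  simp only [prodAlgHom, atVertex, PiTensorProduct.singleAlgHom_apply,
    PiTensorProduct.liftAlgHom_apply, PiTensorProduct.lift.tprod, prodMultilinear,
    MultilinearMap.compLinearMap_apply, MultilinearMap.mkPiAlgebra_apply, MonoidHom.mulSingle_apply,
    AlgHom.toLinearMap_apply]
  rw [Finset.prod_eq_single k (fun j _ hj => by simp [Pi.mulSingle_eq_of_ne hj]) (by simp)]
  simp

lemma prod_atVertex (s : Fin v → FieldAlgebra X) :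
    ∏ i, atVertex i (s i) = PiTensorProduct.tprod ℂ s := by
  simp only [atVertex, PiTensorProduct.singleAlgHom_apply, MonoidHom.mulSingle_apply]
  rw [← PiTensorProduct.tprod_prod, Finset.univ_prod_mulSingle]

lemma vertexTensor_prod_atVertex (ν : FieldAlgebra X →ₗ[ℂ] ℂ) (s : Fin v → FieldAlgebra X) :
    vertexTensor ν v (∏ i, atVertex i (s i)) = ∏ i, ν (s i) := by
  simp [prod_atVertex, vertexTensor, prodMultilinear]

/-- The coproduct on the `i`-th factor as an algebra homomorphism. -/
def coproductAtAlgHom (i : Fin v) : TensorPow X v →ₐ[ℂ] TensorPow X (v + 1) :=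
  prodAlgHom fun k =>
    if k < i then atVertex k.castSucc
    else if k = i then
      (Algebra.TensorProduct.lift (atVertex i.castSucc) (atVertex i.succ)
        fun _ _ => Commute.all _ _).comp (coproduct X)
    else atVertex k.succ

lemma coproductAtAlgHom_apply (i : Fin v) (t : TensorPow X v) :
    coproductAtAlgHom i t = coproductAt i t := by
  simp only [coproductAtAlgHom, coproductAt, prodAlgHom, PiTensorProduct.liftAlgHom_apply,
    apply_ite AlgHom.toLinearMap]

/-- The fibre of `i.predAbove` is `{i, i + 1}` over the split vertex and a single point elsewhere,
so primitivity of the field and the shift of the other factors become one formula. -/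
lemma coproductAtAlgHom_field (i k : Fin v) (x : X) :
    coproductAtAlgHom i (atVertex k (field x)) =
      ∑ j, if i.predAbove j = k then atVertex j (field x) else 0 := by
  rw [coproductAtAlgHom, prodAlgHom_atVertex, Fin.sum_univ_succAbove _ i.succ,
    Fin.predAbove_succ_self]
  simp only [FeynmanGraph.predAbove_succ_succAbove, Finset.sum_ite_eq', Finset.mem_univ, if_true]
  rcases lt_trichotomy k i with h | h | h
  · rw [if_pos h, if_neg h.ne', zero_add, Fin.succAbove_of_castSucc_lt]
    simpa [Fin.lt_def, Nat.lt_succ_iff] using h.le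
  · subst h
    rw [if_neg (lt_irrefl _), if_pos rfl, if_pos rfl,
      Fin.succAbove_of_castSucc_lt _ _ k.castSucc_lt_succ]
    simp [coproduct, field, add_comm]
  · rw [if_neg h.not_gt, if_neg h.ne', if_neg h.ne, zero_add, Fin.succAbove_of_le_castSucc]
    simpa [Fin.le_def, Nat.succ_le_iff] using h

/-- Expansion of the image of a product when the images of the factors are sums over fibres. -/
lemma map_prod_eq_sum_fibre {ι α β A B : Type*} [Fintype ι] [DecidableEq ι] [DecidableEq α]
    [Fintype β] [CommSemiring A] [CommSemiring B] (D : A →+* B) (r : β → α) (a : ι → α → A)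
    (b : ι → β → B) (h : ∀ k i, D (a k i) = ∑ j, if r j = i then b k j else 0) (g : ι → α) :
    D (∏ k, a k (g k)) = ∑ f : ι → β, if r ∘ f = g then ∏ k, b k (f k) else 0 := by
  rw [map_prod]
  simp only [h]
  rw [Finset.prod_univ_sum, Fintype.piFinset_univ]
  refine Finset.sum_congr rfl fun f _ => ?_
  split_ifs with hf
  · exact Finset.prod_congr rfl fun k _ => if_pos (congrFun hf k)
  · obtain ⟨k, hk⟩ := Function.ne_iff.1 hf
    exact Finset.prod_eq_zero (Finset.mem_univ k) (if_neg hk)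

/-! ### Graphs as elements of tensor powers -/

namespace FeynmanGraph

/-- The product of the kernels of the internal edges and of the fields, inserted at the vertices. -/
def insertion (K : X → X → ℂ) (x : Fin n → X) (z : Fin e → X × X) (G : FeynmanGraph v e n) :
    TensorPow X v :=
  (∏ k, atVertex (G.leg k) (field (x k))) *
    ∏ k, K (z k).1 (z k).2 •
      (atVertex (G.ends k).1 (field (z k).1) * atVertex (G.ends k).2 (field (z k).2))

lemma insertion_snoc (K : X → X → ℂ) (x : Fin n → X) (z : Fin (e + 1) → X × X)
    (G : FeynmanGraph v e n) (p : Fin v × Fin v) :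
    (G.snoc p).insertion K x z = K (z (Fin.last e)).1 (z (Fin.last e)).2 •
      (atVertex p.1 (field (z (Fin.last e)).1) * atVertex p.2 (field (z (Fin.last e)).2)) *
        G.insertion K x (Fin.init z) := by
  simp only [insertion, Fin.prod_univ_castSucc, snoc, Fin.snoc_castSucc, Fin.snoc_last, Fin.init]
  ring

/-- The fields are regrouped from a product over edges into a product over vertices, on which `ν`
acts factor by factor. -/
lemma vertexTensor_insertion (K : X → X → ℂ) (ν : FieldAlgebra X →ₗ[ℂ] ℂ) (x : Fin n → X)
    (z : Fin e → X × X) (G : FeynmanGraph v e n) :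
    vertexTensor ν v (G.insertion K x z) = G.integrand K ν x z := by
  have single (j : Fin v) (s : FieldAlgebra X) :
      (atVertex j s : TensorPow X v) = ∏ i, atVertex i (if j = i then s else 1) := by
    rw [Finset.prod_eq_single j (fun i _ hi => by simp [hi.symm]) (by simp)]
    simp
  have : G.insertion K x z = (∏ k, K (z k).1 (z k).2) • ∏ i, atVertex i (G.fieldsAt x z i) := by
    rw [insertion, Finset.prod_smul, mul_smul_comm]
    simp only [fieldsAt, map_mul, map_prod, Finset.prod_mul_distrib]
    congr 2
    · rw [Finset.prod_comm]
      exact Finset.prod_congr rfl fun k _ => single _ _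
    · congr 1
      · rw [Finset.prod_comm]
        exact Finset.prod_congr rfl fun k _ => single _ _
      · rw [Finset.prod_comm]
        exact Finset.prod_congr rfl fun k _ => single _ _
  rw [this, map_smul, vertexTensor_prod_atVertex, integrand, smul_eq_mul]

/-- The coproduct on the `i`-th factor sums over all ways to split the vertex `i`. -/
lemma coproductAt_insertion (K : X → X → ℂ) (x : Fin n → X) (z : Fin e → X × X)
    (G : FeynmanGraph v e n) (i : Fin v) :
    coproductAt i (G.insertion K x z) =
      ∑ H : FeynmanGraph (v + 1) e n, if H.map i.predAbove = G then H.insertion K x z else 0 := by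
  rw [← coproductAtAlgHom_apply, insertion, map_mul]
  have h1 := map_prod_eq_sum_fibre (coproductAtAlgHom (X := X) i).toRingHom i.predAbove
    (fun k j => atVertex j (field (x k))) (fun k j => atVertex j (field (x k)))
    (fun k j => coproductAtAlgHom_field i j (x k)) G.leg
  have h2 := map_prod_eq_sum_fibre (coproductAtAlgHom (X := X) i).toRingHom
    (Prod.map i.predAbove i.predAbove)
    (fun k p => K (z k).1 (z k).2 • (atVertex p.1 (field (z k).1) * atVertex p.2 (field (z k).2)))
    (fun k p => K (z k).1 (z k).2 • (atVertex p.1 (field (z k).1) * atVertex p.2 (field (z k).2)))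
    (fun k p => by
      change coproductAtAlgHom i _ = _
      rw [map_smul, map_mul, coproductAtAlgHom_field, coproductAtAlgHom_field, Finset.sum_mul_sum,
        Fintype.sum_prod_type, Finset.smul_sum]
      refine Finset.sum_congr rfl fun j _ => ?_
      rw [Finset.smul_sum]
      refine Finset.sum_congr rfl fun j' _ => ?_
      by_cases h : i.predAbove j = p.1 <;> by_cases h' : i.predAbove j' = p.2 <;>
        simp [h, h', Prod.ext_iff]) G.ends
  erw [h1, h2]
  rw [Finset.sum_mul_sum, ← equivProd.symm.sum_comp, Fintype.sum_prod_type]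
  refine Finset.sum_congr rfl fun f _ => Finset.sum_congr rfl fun g _ => ?_
  by_cases h : i.predAbove ∘ f = G.leg <;>
    by_cases h' : Prod.map i.predAbove i.predAbove ∘ g = G.ends <;>
    simp [h, h', FeynmanGraph.ext_iff, map, equivProd, insertion]

end FeynmanGraph

/-! ### The action of `T_i`, `Q_i` and `Ω^{l,v}` on weighted sums of graphs. -/

open FeynmanGraph

/-- The formal integral with the given weights for the graphs. -/
def graphIntegral (K : X → X → ℂ) (x : Fin n → X) (c : FeynmanGraph v e n → ℕ) :
    FormalIntegral X v :=
  DirectSum.lof ℂ ℕ (fun e => (Fin e → X × X) → TensorPow X v) e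
    fun z => ∑ G, (c G : ℂ) • G.insertion K x z

lemma edgeOp_graphIntegral (K : X → X → ℂ) (x : Fin n → X) (c : FeynmanGraph v e n → ℕ)
    (i j : Fin v) : edgeOp K i j (graphIntegral K x c) =
      graphIntegral K x fun G : FeynmanGraph v (e + 1) n =>
        if G.ends (Fin.last e) = (i, j) then c G.init else 0 := by
  rw [graphIntegral, edgeOp, DirectSum.toModule_lof, LinearMap.comp_apply, graphIntegral]
  congr 1
  funext z
  rw [← snocEquiv.sum_comp, Fintype.sum_prod_type]
  simp only [snocEquiv, Equiv.coe_fn_mk, snoc_ends_last, init_snoc, Nat.cast_ite, Nat.cast_zero,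
    ite_smul, zero_smul, Finset.sum_ite_eq', Finset.mem_univ, if_true, insertion_snoc]
  simp

lemma coproductAt_graphIntegral (K : X → X → ℂ) (x : Fin n → X) (c : FeynmanGraph v e n → ℕ)
    (i : Fin v) : onIntegrands (coproductAt i) (graphIntegral K x c) =
      graphIntegral K x fun G : FeynmanGraph (v + 1) e n => c (G.map i.predAbove) := by
  rw [graphIntegral, onIntegrands, DirectSum.lmap_lof, graphIntegral]
  congr 1
  funext z
  simp only [LinearMap.compLeft_apply, Function.comp_apply, map_sum, map_smul,
    coproductAt_insertion, Finset.smul_sum, smul_ite, smul_zero]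
  rw [Finset.sum_comm]
  simp

lemma sum_graphIntegral {ι : Type*} (K : X → X → ℂ) (x : Fin n → X) (s : Finset ι)
    (c : ι → FeynmanGraph v e n → ℕ) :
    ∑ i ∈ s, graphIntegral K x (c i) = graphIntegral K x fun G => ∑ i ∈ s, c i G := by
  simp only [graphIntegral]
  rw [← map_sum]
  congr 1
  funext z
  simp only [Finset.sum_apply, Nat.cast_sum, Finset.sum_smul]
  exact Finset.sum_comm

lemma add_graphIntegral (K : X → X → ℂ) (x : Fin n → X) (c d : FeynmanGraph v e n → ℕ) :
    graphIntegral K x c + graphIntegral K x d = graphIntegral K x fun G => c G + d G := by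
  simp only [graphIntegral]
  rw [← map_add]
  congr 1
  funext z
  simp [add_smul, Finset.sum_add_distrib]

lemma sum_opT (K : X → X → ℂ) (x : Fin n → X) (c : FeynmanGraph v e n → ℕ) :
    ∑ i, opT K i (graphIntegral K x c) =
      (1 / 2 : ℂ) • graphIntegral K x fun G : FeynmanGraph v (e + 1) n =>
        if (G.ends (Fin.last e)).1 = (G.ends (Fin.last e)).2 then c G.init else 0 := by
  simp only [opT, LinearMap.smul_apply, ← Finset.smul_sum, edgeOp_graphIntegral, sum_graphIntegral]
  congr 2
  funext G
  obtain ⟨a, b⟩ := G.ends (Fin.last e)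
  by_cases h : a = b
  · subst h; simp
  · have : ∀ i, ¬ (a = i ∧ b = i) := fun i hi => h (hi.1.trans hi.2.symm)
    simp [h, this]

lemma sum_opQ (K : X → X → ℂ) (x : Fin n → X) (c : FeynmanGraph v e n → ℕ) :
    ∑ i, opQ K i (graphIntegral K x c) =
      (1 / 2 : ℂ) • graphIntegral K x fun G : FeynmanGraph (v + 1) (e + 1) n =>
        ∑ i : Fin v, if G.ends (Fin.last e) = (i.castSucc, i.succ) then
          c (G.init.map i.predAbove) else 0 := by
  simp only [opQ, LinearMap.smul_apply, LinearMap.comp_apply, ← Finset.smul_sum,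
    coproductAt_graphIntegral, edgeOp_graphIntegral, sum_graphIntegral]

lemma inv_factorial_smul {M : Type*} [AddCommMonoid M] [Module ℂ M] (e : ℕ) (A : M) :
    ((e + 1 : ℕ) : ℂ)⁻¹ • ((e.factorial * 2 ^ e : ℕ) : ℂ)⁻¹ • (1 / 2 : ℂ) • A =
      (((e + 1).factorial * 2 ^ (e + 1) : ℕ) : ℂ)⁻¹ • A := by
  rw [smul_smul, smul_smul, Nat.factorial_succ, pow_succ]
  congr 1
  push_cast
  field_simp

/-- The maps `Ω^{l,v}` generate each graph with the number of its histories as weight. -/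
theorem Omega_prod_field (K : X → X → ℂ) (x : Fin n → X) : ∀ (l v e : ℕ), e + 1 = l + v → 1 ≤ v →
    Omega K l v (∏ k, field (x k)) =
      ((e.factorial * 2 ^ e : ℕ) : ℂ)⁻¹ • graphIntegral K x (histories (n := n) v e)
  | 0, 1, 0, _, _ => by
    rw [Omega, constIntegral, graphIntegral]
    simp only [LinearMap.comp_apply, Nat.factorial_zero, pow_zero, mul_one, Nat.cast_one, inv_one,
      one_smul]
    congr 1
    funext z
    rw [← equivProd.symm.sum_comp, Fintype.sum_subsingleton _ (fun _ => 0, fun k => k.elim0)]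
    simp [histories, equivProd, insertion]
  | 0, v + 2, 0, h, _ => by omega
  | 0, v + 2, e + 1, h, _ => by
    obtain rfl : e = v := by omega
    rw [Omega]
    simp only [LinearMap.smul_apply, LinearMap.sum_apply, LinearMap.comp_apply]
    rw [Omega_prod_field K x 0 (e + 1) e (by omega) (by omega)]
    simp only [map_smul, ← Finset.smul_sum]
    rw [sum_opQ]
    refine (inv_factorial_smul e _).trans ?_
    congr 2
    funext G
    -- With `e + 2` vertices and `e` remaining edges, the self-loop term vanishes.
    rw [histories, histories_eq_zero e (e + 2) _ (by omega), ite_self, zero_add]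
  | l + 1, v + 1, 0, h, _ => by omega
  | l + 1, v + 1, e + 1, h, _ => by
    obtain rfl : e = l + v := by omega
    rw [Omega]
    simp only [LinearMap.smul_apply, LinearMap.add_apply, LinearMap.sum_apply,
      LinearMap.comp_apply]
    rw [Omega_prod_field K x l (v + 1) (l + v) (by omega) (by omega)]
    -- Rewriting is done under the sum because `v` may be `0`; an index `i` supplies `1 ≤ v`.
    have hQ : ∑ i : Fin v, opQ K i (Omega K (l + 1) v (∏ k, field (x k))) =
        (((l + v).factorial * 2 ^ (l + v) : ℕ) : ℂ)⁻¹ •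
          ∑ i : Fin v, opQ K i (graphIntegral K x (histories (n := n) v (l + v))) := by
      rw [Finset.smul_sum]
      refine Finset.sum_congr rfl fun i _ => ?_
      rw [Omega_prod_field K x (l + 1) v (l + v) (by omega) i.pos, map_smul]
    rw [hQ]
    simp only [map_smul, ← Finset.smul_sum]
    rw [← smul_add, sum_opQ, sum_opT, ← smul_add, add_graphIntegral, inv_factorial_smul]
    congr 2
    funext G
    rw [histories, add_comm]
termination_by l v => (l, v)

end FeynmanHopf

namespace FeynmanHopf

variable {X : Type*} {v w e n : ℕ}

namespace FeynmanGraph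

lemma Iso.connected {G H : FeynmanGraph v e n} (f : Iso G H) (hG : G.Connected) : H.Connected := by
  rw [connected_iff] at hG ⊢
  refine ⟨hG.1, fun S hS a b ha => ?_⟩
  have := hG.2 (S ∘ f.vertex) (fun k => ?_) (f.vertex.symm a) (f.vertex.symm b) (by simpa using ha)
  · simpa using this
  · have := hS (f.edge k)
    rw [f.ends_eq k] at this
    cases h : f.flip k <;> simpa [h, iff_comm] using this

/-! ### Counting isomorphisms -/

/-- Relabelling data determine the target, which gives the injectivity used for `sum_card_iso`. -/
lemma Iso.target_eq {G H H' : FeynmanGraph v e n} (f : Iso G H) (f' : Iso G H')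
    (hv : f.vertex = f'.vertex) (he : f.edge = f'.edge) (hf : f.flip = f'.flip) : H = H' := by
  ext1
  · funext k
    rw [f.leg_eq, f'.leg_eq, hv]
  · funext k
    obtain ⟨k, rfl⟩ := f.edge.surjective k
    rw [f.ends_eq, he, f'.ends_eq, hv, hf]

instance (G H : FeynmanGraph v e n) : Finite (Iso G H) :=
  Finite.of_injective (fun f => (f.vertex, f.edge, f.flip)) fun f g h => by
    simp only [Prod.mk.injEq] at h
    exact Iso.ext h.1 h.2.1 h.2.2

lemma card_iso_eq {G H : FeynmanGraph v e n} (f : Iso G H) :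
    Nat.card (Iso G H) = G.symmetryFactor :=
  Nat.card_congr
    { toFun := fun g => g.trans f.symm
      invFun := fun g => g.trans f
      left_inv := fun g => by
        ext
        · simp [Iso.trans, Iso.symm]
        · simp [Iso.trans, Iso.symm]
        · simp [Iso.trans, Iso.symm]
      right_inv := fun g => by
        ext
        · simp [Iso.trans, Iso.symm]
        · simp [Iso.trans, Iso.symm]
        · simp [Iso.trans, Iso.symm] }

instance : Fintype {G : FeynmanGraph v e n // G.Connected} := Fintype.ofFinite _

/-- Orbit counting: every permutation of vertices, permutation of edges and choice of flips has
exactly one target, again connected. Flips of self-loops count as distinct data, as they do in the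
symmetry factor. -/
lemma sum_card_iso {G : FeynmanGraph v e n} (hG : G.Connected) :
    ∑ H : {H : FeynmanGraph v e n // H.Connected}, Nat.card (Iso G H.1) =
      v.factorial * (e.factorial * 2 ^ e) := by
  rw [← Nat.card_sigma]
  let t : (Σ H : {H : FeynmanGraph v e n // H.Connected}, Iso G H.1) →
      Equiv.Perm (Fin v) × Equiv.Perm (Fin e) × (Fin e → Bool) :=
    fun p => (p.2.vertex, p.2.edge, p.2.flip)
  have ht : Function.Bijective t := by
    constructor
    · rintro ⟨⟨H, hH⟩, f⟩ ⟨⟨H', hH'⟩, f'⟩ h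
      simp only [t, Prod.mk.injEq] at h
      obtain rfl := f.target_eq f' h.1 h.2.1 h.2.2
      obtain rfl : f = f' := Iso.ext h.1 h.2.1 h.2.2
      rfl
    · rintro ⟨π, σ, ε⟩
      let H : FeynmanGraph v e n :=
        { leg := fun k => π (G.leg k)
          ends := fun k => if ε (σ⁻¹ k) then (π (G.ends (σ⁻¹ k)).2, π (G.ends (σ⁻¹ k)).1)
            else (π (G.ends (σ⁻¹ k)).1, π (G.ends (σ⁻¹ k)).2) }
      let f : Iso G H :=
        { vertex := π
          edge := σ
          flip := ε
          leg_eq := fun k => rfl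
          ends_eq := fun k => by simp [H] }
      exact ⟨⟨⟨H, f.connected hG⟩, f⟩, rfl⟩
  rw [Nat.card_congr (Equiv.ofBijective t ht)]
  simp [Fintype.card_perm]

/-! ### Invariance of the value of a graph -/

lemma Iso.integrand_eq {K : X → X → ℂ} (hK : ∀ x y, K x y = K y x) (ν : FieldAlgebra X →ₗ[ℂ] ℂ)
    {G H : FeynmanGraph v e n} (f : Iso G H) (x : Fin n → X) (z : Fin e → X × X) :
    H.integrand K ν x z =
      G.integrand K ν x fun k => if f.flip k then (z (f.edge k)).swap else z (f.edge k) := by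
  rw [integrand, integrand]
  congr 1
  · rw [← Equiv.prod_comp f.edge]
    refine Finset.prod_congr rfl fun k _ => ?_
    cases h : f.flip k
    · simp
    · simp [hK (z (f.edge k)).1]
  · rw [← Equiv.prod_comp f.vertex]
    refine Finset.prod_congr rfl fun i _ => ?_
    congr 1
    rw [fieldsAt, fieldsAt]
    congr 1
    · simp [f.leg_eq]
    · rw [← Equiv.prod_comp f.edge]
      refine Finset.prod_congr rfl fun k _ => ?_
      rw [f.ends_eq]
      cases h : f.flip k
      · simp
      · simp [mul_comm]

/-- Permuting the integration variables preserves the product measure, and swapping the two labels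
of a flipped edge preserves `κ`. -/
lemma Iso.value_eq [MeasurableSpace X] {κ : Measure (X × X)} [SigmaFinite κ]
    (hκ : κ.map Prod.swap = κ) {K : X → X → ℂ} (hK : ∀ x y, K x y = K y x)
    (ν : FieldAlgebra X →ₗ[ℂ] ℂ) {G H : FeynmanGraph v e n} (f : Iso G H) (x : Fin n → X) :
    H.value κ K ν x = G.value κ K ν x := by
  let s (k : Fin e) : X × X ≃ᵐ X × X :=
    if f.flip k then MeasurableEquiv.prodComm else MeasurableEquiv.refl _
  have hs (k : Fin e) : MeasurePreserving (s k) κ κ := by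
    by_cases h : f.flip k
    · simp only [s, h, if_true]
      exact ⟨measurable_swap, hκ⟩
    · simp only [s, h]
      exact MeasurePreserving.id κ
  have h1 := measurePreserving_piCongrLeft (fun _ : Fin e => κ) f.edge.symm
  have h2 : MeasurePreserving (MeasurableEquiv.piCongrRight s) (Measure.pi fun _ => κ)
      (Measure.pi fun _ => κ) := measurePreserving_pi (fun _ => κ) (fun _ => κ) hs
  -- The change of variables is a measurable embedding, so neither measurability nor integrability
  -- of the integrand is needed.
  have h3 := (h2.comp h1).integral_comp ((MeasurableEquiv.piCongrRight s).measurableEmbedding.comp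
    (MeasurableEquiv.measurableEmbedding _)) (G.integrand K ν x)
  rw [value, value, ← h3]
  refine integral_congr_ae (Filter.Eventually.of_forall fun z => ?_)
  simp only [f.integrand_eq hK]
  congr 1
  funext k
  have : (MeasurableEquiv.piCongrLeft (fun _ : Fin e => X × X) f.edge.symm) z k = z (f.edge k) := by
    simp [MeasurableEquiv.piCongrLeft, Equiv.piCongrLeft, Equiv.piCongrLeft']
  change _ = s k ((MeasurableEquiv.piCongrLeft (fun _ : Fin e => X × X) f.edge.symm) z k)
  rw [this]
  by_cases h : f.flip k
  · simp only [s, h, if_true]; rfl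
  · simp only [s, h]; rfl

/-! ### Averaging over numberings and orientations. -/

/-- Renumbering the vertices and reversing some of the internal edges. -/
def relabelEquiv (π : Equiv.Perm (Fin v)) (ε : Fin e → Bool) :
    FeynmanGraph v e n ≃ FeynmanGraph v e n where
  toFun G := (G.flipEnds ε).map π
  invFun G := (G.map π.symm).flipEnds ε
  left_inv G := by
    beta_reduce
    rw [map_comp, flipEnds_map, flipEnds_flipEnds]
    simp [map]
  right_inv G := by
    beta_reduce
    rw [flipEnds_flipEnds, map_comp]
    simp [map]

/-- A relabelled graph is isomorphic to the original graph. -/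
def relabelIso (π : Equiv.Perm (Fin v)) (ε : Fin e → Bool) (G : FeynmanGraph v e n) :
    Iso G ((G.flipEnds ε).map π) where
  vertex := π
  edge := 1
  flip := ε
  leg_eq _ := rfl
  ends_eq k := by
    cases h : ε k <;> simp [flipEnds, h, Prod.map]

/-- Relabelling permutes the graphs without changing their values, so the weights may be averaged
over all `v! 2 ^ e` pairs `(π, ε)`; `sum_histories` evaluates the average. -/
lemma sum_histories_mul_value [MeasurableSpace X] {κ : Measure (X × X)} [SigmaFinite κ]
    (hκ : κ.map Prod.swap = κ) {K : X → X → ℂ} (hK : ∀ x y, K x y = K y x)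
    (ν : FieldAlgebra X →ₗ[ℂ] ℂ) (x : Fin n → X) :
    ∑ G : FeynmanGraph v e n, (histories v e G : ℂ) * G.value κ K ν x =
    (v.factorial : ℂ)⁻¹ * ∑ G : {G : FeynmanGraph v e n // G.Connected}, G.1.value κ K ν x := by
  classical
  have h : ((v.factorial * 2 ^ e : ℕ) : ℂ) *
      ∑ G : FeynmanGraph v e n, (histories v e G : ℂ) * G.value κ K ν x =
      ∑ G : FeynmanGraph v e n, ((if G.Connected then 2 ^ e else 0 : ℕ) : ℂ) * G.value κ K ν x := by
    calc _ = ∑ π : Equiv.Perm (Fin v), ∑ ε : Fin e → Bool,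
          ∑ G : FeynmanGraph v e n, (histories v e G : ℂ) * G.value κ K ν x := by
          simp [Fintype.card_perm, mul_assoc]
      _ = ∑ π : Equiv.Perm (Fin v), ∑ ε : Fin e → Bool, ∑ G : FeynmanGraph v e n,
          (histories v e ((G.flipEnds ε).map π) : ℂ) * G.value κ K ν x := by
          refine Finset.sum_congr rfl fun π _ => Finset.sum_congr rfl fun ε _ => ?_
          rw [← (relabelEquiv π ε).sum_comp]
          refine Finset.sum_congr rfl fun G _ => ?_
          rw [← (relabelIso π ε G).value_eq hκ hK ν x]
          rfl
      _ = _ := by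
          simp only [← sum_histories, Nat.cast_sum, Finset.sum_mul]
          rw [Finset.sum_comm' (t' := Finset.univ) (s' := fun _ => Finset.univ) (by simp)]
          conv_rhs => rw [Finset.sum_comm]
          rw [Finset.sum_comm]
          exact Finset.sum_congr rfl fun π _ => Finset.sum_comm
  have hv : (v.factorial : ℂ) ≠ 0 := by exact_mod_cast v.factorial_ne_zero
  rw [eq_inv_mul_iff_mul_eq₀ hv]
  have h2 : (2 ^ e : ℂ) ≠ 0 := pow_ne_zero _ two_ne_zero
  refine mul_left_cancel₀ h2 ?_
  rw [← mul_assoc, mul_comm (2 ^ e : ℂ)]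
  push_cast at h
  rw [h]
  simp only [ite_mul, zero_mul]
  rw [← Finset.sum_filter, Finset.mul_sum, Finset.sum_subtype (p := Connected) _ (by simp)]

end FeynmanGraph

/-! ### From isomorphism classes to numbered graphs. -/

open FeynmanGraph

/-- The sum over isomorphism classes as a sum over graphs with numbered vertices and edges. -/
lemma connectedContribution_eq [MeasurableSpace X] {κ : Measure (X × X)} [SigmaFinite κ]
    (hκ : κ.map Prod.swap = κ) {K : X → X → ℂ} (hK : ∀ x y, K x y = K y x)
    (ν : FieldAlgebra X →ₗ[ℂ] ℂ) (l v : ℕ) (x : Fin n → X) :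
    connectedContribution κ K ν l v x =
      ((v.factorial * ((l + v - 1).factorial * 2 ^ (l + v - 1)) : ℕ) : ℂ)⁻¹ *
        ∑ G : ConnectedGraph l v n, G.1.value κ K ν x := by
  classical
  have : Fintype (Quotient (isoSetoid l v n)) := Fintype.ofFinite _
  rw [connectedContribution, finsum_eq_sum_of_fintype,
    ← Finset.sum_fiberwise Finset.univ (fun G => (⟦G⟧ : Quotient (isoSetoid l v n))),
    Finset.mul_sum]
  refine Finset.sum_congr rfl fun q _ => ?_
  have hiso (H : ConnectedGraph l v n) :
      (⟦H⟧ : Quotient (isoSetoid l v n)) = q ↔ Nonempty (Iso q.out.1 H.1) := by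
    conv_lhs => rw [← q.out_eq]
    rw [eq_comm, Quotient.eq]
    rfl
  have hval : ∑ H : ConnectedGraph l v n with (⟦H⟧ : Quotient (isoSetoid l v n)) = q,
      H.1.value κ K ν x =
      (Finset.univ.filter fun H : ConnectedGraph l v n =>
        (⟦H⟧ : Quotient (isoSetoid l v n)) = q).card * q.out.1.value κ K ν x := by
    rw [← nsmul_eq_mul, ← Finset.sum_const]
    refine Finset.sum_congr rfl fun H hH => ?_
    obtain ⟨f⟩ := (hiso H).1 (Finset.mem_filter.1 hH).2
    exact f.value_eq hκ hK ν x
  -- Each member of the class contributes `symmetryFactor` isomorphisms to the count of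
  -- `sum_card_iso`, and all other graphs contribute none.
  have hcard : (Finset.univ.filter fun H : ConnectedGraph l v n =>
      (⟦H⟧ : Quotient (isoSetoid l v n)) = q).card * q.out.1.symmetryFactor =
      v.factorial * ((l + v - 1).factorial * 2 ^ (l + v - 1)) := by
    rw [← sum_card_iso q.out.2, ← smul_eq_mul, ← Finset.sum_const, Finset.sum_filter]
    refine Finset.sum_congr rfl fun H _ => ?_
    split_ifs with h
    · obtain ⟨f⟩ := (hiso H).1 h
      exact (card_iso_eq f).symm
    · rw [hiso, not_nonempty_iff] at h
      exact Nat.card_of_isEmpty.symm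
  rw [hval, ← hcard]
  have hpos : (Finset.univ.filter fun H : ConnectedGraph l v n =>
      (⟦H⟧ : Quotient (isoSetoid l v n)) = q).card ≠ 0 := by
    rw [Finset.card_ne_zero]
    exact ⟨q.out, by simp⟩
  have hpos' : ((Finset.univ.filter fun H : ConnectedGraph l v n =>
      (⟦H⟧ : Quotient (isoSetoid l v n)) = q).card : ℂ) ≠ 0 := Nat.cast_ne_zero.2 hpos
  rw [Nat.cast_mul, mul_inv, mul_mul_mul_comm, inv_mul_cancel₀ hpos', one_mul]

/-! ### Application of the vertex functions -/

lemma vertexTensor_graphIntegral_self (K : X → X → ℂ) (ν : FieldAlgebra X →ₗ[ℂ] ℂ) (x : Fin n → X)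
    (c : FeynmanGraph v e n → ℕ) (z : Fin e → X × X) :
    vertexTensor ν v (graphIntegral K x c e z) = ∑ G, (c G : ℂ) * G.integrand K ν x z := by
  rw [graphIntegral, DirectSum.lof_apply]
  simp [vertexTensor_insertion]

lemma graphIntegral_of_ne (K : X → X → ℂ) (x : Fin n → X) (c : FeynmanGraph v e n → ℕ) {e' : ℕ}
    (h : e' ≠ e) : graphIntegral K x c e' = 0 := by
  rw [graphIntegral, DirectSum.lof_eq_of, DirectSum.of_eq_of_ne _ _ _ h]

lemma vertexTensor_smul_apply (ν : FieldAlgebra X →ₗ[ℂ] ℂ) (a : ℂ) (f : FormalIntegral X v) (e : ℕ)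
    (z : Fin e → X × X) :
    vertexTensor ν v ((a • f) e z) = a * vertexTensor ν v (f e z) := by
  rw [DirectSum.smul_apply, Pi.smul_apply, map_smul, smul_eq_mul]

section

variable [MeasurableSpace X] (κ : Measure (X × X)) (ν : FieldAlgebra X →ₗ[ℂ] ℂ)

lemma converges_add {f g : FormalIntegral X v} (hf : Converges κ ν f) (hg : Converges κ ν g) :
    Converges κ ν (f + g) := fun e =>
  ((hf e).add (hg e)).congr (Filter.Eventually.of_forall fun z => by simp)

lemma converges_smul {f : FormalIntegral X v} (a : ℂ) (hf : Converges κ ν f) :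
    Converges κ ν (a • f) := fun e => by
  simpa only [vertexTensor_smul_apply] using (hf e).const_mul a

lemma finite_support_integral (f : FormalIntegral X v) :
    (Function.support fun e =>
      ∫ z, vertexTensor ν v (f e z) ∂(Measure.pi fun _ : Fin e => κ)).Finite := by
  refine (DFinsupp.finite_support f).subset fun e he h => he ?_
  have h : f e = 0 := h
  simp [h]

lemma applyVertex_add {f g : FormalIntegral X v} (hf : Converges κ ν f) (hg : Converges κ ν g) :
    applyVertex κ ν (f + g) = applyVertex κ ν f + applyVertex κ ν g := by
  rw [applyVertex, applyVertex, applyVertex,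
    ← finsum_add_distrib (finite_support_integral κ ν f) (finite_support_integral κ ν g)]
  refine finsum_congr fun e => ?_
  rw [← integral_add (hf e) (hg e)]
  simp

lemma applyVertex_smul (a : ℂ) (f : FormalIntegral X v) :
    applyVertex κ ν (a • f) = a * applyVertex κ ν f := by
  rw [applyVertex, applyVertex, ← smul_eq_mul, smul_finsum]
  refine finsum_congr fun e => ?_
  simp only [vertexTensor_smul_apply, integral_const_mul, smul_eq_mul]

variable {κ ν}

lemma integrable_histories_mul_integrand {K : X → X → ℂ} {x : Fin n → X}
    (h : ∀ G : FeynmanGraph v e n, G.Connected →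
      Integrable (G.integrand K ν x) (Measure.pi fun _ : Fin e => κ)) (G : FeynmanGraph v e n) :
    Integrable (fun z => (histories v e G : ℂ) * G.integrand K ν x z)
      (Measure.pi fun _ : Fin e => κ) := by
  by_cases hG : histories v e G = 0
  · simp [hG]
  · exact (h G (connected_of_histories_ne_zero hG)).const_mul _

lemma converges_graphIntegral {K : X → X → ℂ} {x : Fin n → X}
    (h : ∀ G : FeynmanGraph v e n, G.Connected →
      Integrable (G.integrand K ν x) (Measure.pi fun _ : Fin e => κ)) :
    Converges κ ν (graphIntegral K x (histories (n := n) v e)) := fun e' => by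
  by_cases he : e' = e
  · subst he
    simp only [vertexTensor_graphIntegral_self]
    exact integrable_finsetSum _ fun G _ => integrable_histories_mul_integrand h G
  · simp [graphIntegral_of_ne K x _ he]

lemma applyVertex_graphIntegral {K : X → X → ℂ} {x : Fin n → X}
    (h : ∀ G : FeynmanGraph v e n, G.Connected →
      Integrable (G.integrand K ν x) (Measure.pi fun _ : Fin e => κ)) :
    applyVertex κ ν (graphIntegral K x (histories (n := n) v e)) =
      ∑ G : FeynmanGraph v e n, (histories v e G : ℂ) * G.value κ K ν x := by
  rw [applyVertex, finsum_eq_single _ e fun e' he => by simp [graphIntegral_of_ne K x _ he]]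
  simp only [vertexTensor_graphIntegral_self]
  rw [integral_finsetSum _ fun G _ => integrable_histories_mul_integrand h G]
  simp only [integral_const_mul, value]

end

lemma prod_field_toList (m : X →₀ ℕ) :
    ∏ k, field ((Finsupp.toMultiset m).toList.get k) = MvPolynomial.monomial m (1 : ℂ) := by
  have : ∏ k, field ((Finsupp.toMultiset m).toList.get k) =
      ((Finsupp.toMultiset m).map field).prod := by
    conv_rhs => rw [← (Finsupp.toMultiset m).coe_toList]
    rw [Multiset.map_coe, Multiset.prod_coe, ← List.prod_ofFn]
    congr 1
    rw [List.ofFn_comp' _ field, List.ofFn_get]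
  rw [this, Finsupp.toMultiset_map, Finsupp.prod_toMultiset,
    Finsupp.prod_mapDomain_index (by simp) (fun _ _ _ => pow_add _ _ _), MvPolynomial.monomial_eq,
    MvPolynomial.C_1, one_mul]
  rfl

end FeynmanHopf

end

/-! ### Comparison of the two sides and extension by linearity. -/

theorem corollary2 {X : Type*} [MeasurableSpace X]
    (κ : Measure (X × X)) [SigmaFinite κ] (hκ : κ.map Prod.swap = κ)
    (K : X → X → ℂ) (hK : ∀ x y, K x y = K y x)
    (ν : FieldAlgebra X →ₗ[ℂ] ℂ) (l v : ℕ) (hv : 1 ≤ v)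
    (hconv : ∀ (n : ℕ) (x : Fin n → X) (G : ConnectedGraph l v n),
      Integrable (G.1.integrand K ν x) (Measure.pi fun _ : Fin (l + v - 1) => κ)) :
    (∀ (n : ℕ) (x : Fin n → X),
      sigma κ K ν l v (∏ k, field (x k)) = connectedContribution κ K ν l v x) ∧
    (∀ s : FieldAlgebra X, Converges κ ν (Omega K l v s)) ∧
    (∀ s : FieldAlgebra X, sigma κ K ν l v s = applyVertex κ ν (Omega K l v s)) := by
  have hOmega (n : ℕ) (x : Fin n → X) :=
    Omega_prod_field K x l v (l + v - 1) (by omega) hv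
  have hprod (n : ℕ) (x : Fin n → X) : Converges κ ν (Omega K l v (∏ k, field (x k))) := by
    rw [hOmega]
    exact converges_smul κ ν _ (converges_graphIntegral fun G hG => hconv n x ⟨G, hG⟩)
  have happly (n : ℕ) (x : Fin n → X) : applyVertex κ ν (Omega K l v (∏ k, field (x k))) =
      connectedContribution κ K ν l v x := by
    -- Both sides become `(v! e! 2 ^ e)⁻¹` times the sum of the values of all connected numbered
    -- graphs.
    rw [hOmega, applyVertex_smul, applyVertex_graphIntegral fun G hG => hconv n x ⟨G, hG⟩,
      FeynmanGraph.sum_histories_mul_value hκ hK, connectedContribution_eq hκ hK,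
      Nat.cast_mul v.factorial, mul_inv, mul_assoc, mul_left_comm]
  have hmono (m : X →₀ ℕ) (a : ℂ) : MvPolynomial.monomial m a =
      a • ∏ k, field ((Finsupp.toMultiset m).toList.get k) := by
    rw [prod_field_toList, MvPolynomial.smul_monomial, smul_eq_mul, mul_one]
  -- Convergence and equality are proved together, since additivity of the integrals requires
  -- convergence of both summands.
  have hboth (s : FieldAlgebra X) : Converges κ ν (Omega K l v s) ∧
      sigma κ K ν l v s = applyVertex κ ν (Omega K l v s) := by
    induction s using MvPolynomial.induction_on' with
    | monomial m a =>
      refine ⟨?_, ?_⟩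
      · rw [hmono, map_smul]
        exact converges_smul κ ν a (hprod _ _)
      · have hσ : sigma κ K ν l v (MvPolynomial.monomial m 1) =
            connectedContribution κ K ν l v (Finsupp.toMultiset m).toList.get := by
          rw [sigma, ← congrFun (MvPolynomial.coe_basisMonomials X ℂ) m,
            Module.Basis.constr_basis]
        rw [hmono, map_smul, map_smul, applyVertex_smul, happly, prod_field_toList, hσ, smul_eq_mul]
    | add p q hp hq =>
      rw [map_add, map_add]
      exact ⟨converges_add κ ν hp.1 hq.1, by rw [applyVertex_add κ ν hp.1 hq.1, hp.2, hq.2]⟩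
  -- `sigma` was defined with a chosen ordering of each monomial. Independence of the ordering
  -- follows because `happly` holds for every tuple `x` and `Omega` sees only the product.
  exact ⟨fun n x => (hboth _).2.trans (happly n x), fun s => (hboth s).1, fun s => (hboth s).2⟩
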